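/- **Setting.** Let $m\le n$. For $X\in\mathbb{R}^{m\times n}$ let $\sigma_1(X)\ge\dots\ge\sigma_m(X)\ge 0$ be its singular values, $\mathcal I(X)=\{i\in[m]:\sigma_i(X)>0\}$ and $\mathcal Z(X)=[m]\setminus\mathcal I(X)$; $\|\cdot\|_F$ and $\langle\cdot,\cdot\rangle$ are the Frobenius norm and inner product. Let $\lambda>0$, $0<p<1$, $L_f\ge 0$, $\beta>L_f$, $\mu\in(0,1)$. Let $f:\mathbb{R}^{m\times n}\to\mathbb{R}$ be differentiable with $\|\nabla f(X)-\nabla f(Y)\|_F\le L_f\|X-Y\|_F$ for all $X,Y$, and suppose that $F(X)=f(X)+\lambda\sum_{i=1}^m\sigma_i(X)^p$ is level-bounded, i.e. all sets $\{F\le c\}$, $c\in\mathbb R$, are bounded. Let $\bar\alpha>0$ satisfy $\bar\alpha<1$ if $f$ is convex, and $\bar\alpha<\sqrt{\beta/(\beta+3L_f)}$ otherwise. **Algorithm (EIRNRI).** Start from any $X^0=X^{-1}\in\mathbb{R}^{m\times n}$ and any $\epsilon^0\in\mathbb{R}^m$ with $\epsilon^0_1\ge\dots\ge\epsilon^0_m>0$.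 For $k=0,1,2,\dots$, with any $\alpha_k\in[0,\bar\alpha]$, set $w_i^k=p(\sigma_i(X^k)+\epsilon_i^k)^{p-1}$ and $Y^k=X^k+\alpha_k(X^k-X^{k-1})$, let $X^{k+1}$ be any global minimizer over $X\in\mathbb{R}^{m\times n}$ of $$f(Y^k)+\langle X,\nabla f(Y^k)\rangle+\tfrac{\beta}{2}\|X-Y^k\|_F^2+\tfrac{\beta}{2}\|X-X^k\|_F^2+\lambda\sum_{i=1}^m w_i^k\sigma_i(X),$$ and define $\epsilon^{k+1}$ as follows. Write $\mathcal I=\mathcal I(X^k)$, $\mathcal I'=\mathcal I(X^{k+1})$, $r=|\mathcal I|$, $r'=|\mathcal I'|$, $\tau_1=\sigma_{r'}(X^{k+1})+\epsilon^{k+1}_{r'}$ and $\tau_2=\epsilon^k_{r'+1}$, where $\tau_1=+\infty$ if $r'=0$. To *trim* index $i$ means to set $\epsilon_i^{k+1}=\epsilon_i^k$ if $\tau_1\ge\tau_2$, and $\epsilon_i^{k+1}=\min\{\epsilon_i^k,\mu\tau_1\}$ otherwise. 1. If $\mathcal I'\subsetneq\mathcal I$: $\epsilon_i^{k+1}=\mu\epsilon_i^k$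 for $i\in\mathcal I'$; trim every $i\in\mathcal I\setminus\mathcal I'$; then $\epsilon_i^{k+1}=\min\{\epsilon_i^k,\epsilon_r^{k+1}\}$ for $i\in\mathcal Z(X^k)$. 2. If $\mathcal I\subsetneq\mathcal I'$: $\epsilon_i^{k+1}=\mu\epsilon_i^k$ for $i\in\mathcal I$; $\epsilon_i^{k+1}=\mu\min\{\epsilon_i^k,\tau_3\}$ for $i\in\mathcal I'\setminus\mathcal I$, where $\tau_3=\epsilon_r^k$ if $r\ge 1$ and $\tau_3=+\infty$ if $r=0$; trim every $i\in\mathcal Z(X^{k+1})$. 3. If $\mathcal I=\mathcal I'$: $\epsilon_i^{k+1}=\mu\epsilon_i^k$ for $i\in\mathcal I'$; trim every $i\in\mathcal Z(X^{k+1})$. **Theorem.** Let $\{X^k\}$, $\{Y^k\}$, $\{\epsilon^k\}$ be (infinite) sequences generated by this algorithm. There is a constant $C_1>0$ such that $$\max_{i\in[m]}\ \sigma_i\Big(\tfrac{X^k+Y^k}{2}-\tfrac1{2\beta}\nabla f(Y^k)\Big)\le C_1\qquad\text{for all }k\ge 0,\tag{$*$}$$ and there is a set $\mathcal I^*\subseteq[m]$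 such that, with $r^*=|\mathcal I^*|$, one has $\mathcal I(X^k)=\mathcal I^*$ and $\mathrm{Rank}(X^k)=r^*$ for all sufficiently large $k$. Moreover, every limit point $X^*$ of $\{X^k\}$ satisfies $\mathrm{Rank}(X^*)=|\mathcal I(X^*)|=r^*$ and, for every constant $C_1>0$ with $(*)$, $$\sigma_i(X^*)\ \ge\ \Big(\frac{\lambda p}{2\beta C_1}\Big)^{\frac1{1-p}}>0\qquad\text{for all }i\in\mathcal I(X^*).$$ -/

import Mathlib

open Filter Topology
open scoped Matrix.Norms.Frobenius

namespace EIRNRI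

noncomputable section

/-- The singular values `σ₁(X) ≥ ⋯ ≥ σₘ(X) ≥ 0` of a real `m × n` matrix (used for `m ≤ n`), counted
with multiplicity; the `j`-th one in the usual numbering is `sv X i` with `i = j - 1`. -/
def sv {m n : ℕ} (X : Matrix (Fin m) (Fin n) ℝ) (i : Fin m) : ℝ :=
  (Matrix.toEuclideanLin X).singularValues (i : ℕ)

/-- `I(X)`: the indices of the positive singular values of `X`. -/
def posIdx {m n : ℕ} (X : Matrix (Fin m) (Fin n) ℝ) : Finset (Fin m) :=
  Finset.univ.filter fun i => 0 < sv X i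

/-- The Frobenius gradient of `f` at `X`: the matrix of the partial derivatives of `f`. -/
def grad {m n : ℕ} (f : Matrix (Fin m) (Fin n) ℝ → ℝ) (X : Matrix (Fin m) (Fin n) ℝ) :
    Matrix (Fin m) (Fin n) ℝ :=
  Matrix.of fun i j => fderiv ℝ f X (Matrix.single i j 1)

/-- `f` is differentiable and its gradient is `L`-Lipschitz in the Frobenius norm. -/
def IsLSmooth {m n : ℕ} (f : Matrix (Fin m) (Fin n) ℝ → ℝ) (L : ℝ) : Prop :=
  Differentiable ℝ f ∧ 0 ≤ L ∧ ∀ X Y, ‖grad f X - grad f Y‖ ≤ L * ‖X - Y‖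

/-- `F(X) = f(X) + lam ‖X‖ₚᵖ`, where `‖X‖ₚᵖ = ∑ᵢ σᵢ(X)ᵖ`. -/
def objective {m n : ℕ} (f : Matrix (Fin m) (Fin n) ℝ → ℝ) (lam p : ℝ)
    (X : Matrix (Fin m) (Fin n) ℝ) : ℝ :=
  f X + lam * ∑ i, sv X i ^ p

/-- Every sublevel set of `F` is bounded. -/
def IsLevelBounded {m n : ℕ} (F : Matrix (Fin m) (Fin n) ℝ → ℝ) : Prop :=
  ∀ c : ℝ, ∃ R : ℝ, ∀ X, F X ≤ c → ‖X‖ ≤ R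

/-- The weights `wᵢ = p (σᵢ(X) + εᵢ)^(p - 1)`. -/
def weight {m n : ℕ} (p : ℝ) (X : Matrix (Fin m) (Fin n) ℝ) (ε : Fin m → ℝ) (i : Fin m) : ℝ :=
  p * (sv X i + ε i) ^ (p - 1)

/-- The subproblem objective
`Z ↦ f(Y) + ⟨Z, ∇f(Y)⟩ + β/2 ‖Z - Y‖² + β/2 ‖Z - X‖² + lam ∑ᵢ wᵢ σᵢ(Z)`. -/
def surrogate {m n : ℕ} (f : Matrix (Fin m) (Fin n) ℝ → ℝ) (lam p β : ℝ)
    (X Y : Matrix (Fin m) (Fin n) ℝ) (ε : Fin m → ℝ) (Z : Matrix (Fin m) (Fin n) ℝ) : ℝ :=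
  f Y + (Z.transpose * grad f Y).trace + β / 2 * ‖Z - Y‖ ^ 2 + β / 2 * ‖Z - X‖ ^ 2
    + lam * ∑ i, weight p X ε i * sv Z i

/-- The `j`-th entry of `v` in the numbering `1, …, m` (outside that range it is `0`, a value that
the update rule below never uses). -/
def entry {m : ℕ} (v : Fin m → ℝ) (j : ℕ) : ℝ :=
  if h : 1 ≤ j ∧ j ≤ m then v ⟨j - 1, by omega⟩ else 0

/-- The trimming step for an index `i` of a zero singular value of the new iterate `X'`, with
`τ₁ = σ'_{r'} + ε'_{r'}` and `τ₂ = ε_{r'+1}`, `r' = |I(X')|`: the value stays `ε i` if `τ₁ ≥ τ₂` and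
becomes `min (ε i) (μ τ₁)` otherwise. If `I(X')` is empty, `τ₁` is a minimum over the empty set, that
is `+∞`, and the value stays. -/
def trim {m n : ℕ} (μ : ℝ) (X' : Matrix (Fin m) (Fin n) ℝ) (ε ε' : Fin m → ℝ) (i : Fin m) : ℝ :=
  if (posIdx X').card = 0 ∨
      entry ε ((posIdx X').card + 1)
        ≤ entry (sv X') (posIdx X').card + entry ε' (posIdx X').card
  then ε i
  else min (ε i) (μ * (entry (sv X') (posIdx X').card + entry ε' (posIdx X').card))

/-- The adaptive update of the perturbation: `ε` is the vector at the iterate `X`, and `ε'` the one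
at the next iterate `X'`. In the second case the threshold `τ₃ = ε_{|I(X)|}` is `+∞` if `I(X)` is
empty. -/
def IsPerturbationUpdate {m n : ℕ} (μ : ℝ) (X X' : Matrix (Fin m) (Fin n) ℝ)
    (ε ε' : Fin m → ℝ) : Prop :=
  (posIdx X' ⊂ posIdx X →
    (∀ i ∈ posIdx X', ε' i = μ * ε i) ∧
    (∀ i ∈ posIdx X \ posIdx X', ε' i = trim μ X' ε ε' i) ∧
    (∀ i ∉ posIdx X, ε' i = min (ε i) (entry ε' (posIdx X).card))) ∧
  (posIdx X ⊂ posIdx X' →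
    (∀ i ∈ posIdx X, ε' i = μ * ε i) ∧
    (∀ i ∈ posIdx X' \ posIdx X,
      ε' i = μ * (if (posIdx X).card = 0 then ε i else min (ε i) (entry ε (posIdx X).card))) ∧
    (∀ i ∉ posIdx X', ε' i = trim μ X' ε ε' i)) ∧
  (posIdx X = posIdx X' →
    (∀ i ∈ posIdx X', ε' i = μ * ε i) ∧
    (∀ i ∉ posIdx X', ε' i = trim μ X' ε ε' i))

/-- The admissible range of the bound `αbar` on the extrapolation parameters. -/
def IsAdmissibleBound {m n : ℕ} (f : Matrix (Fin m) (Fin n) ℝ → ℝ) (L β αbar : ℝ) : Prop :=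
  0 < αbar ∧
    ((ConvexOn ℝ Set.univ f ∧ αbar < 1) ∨ αbar < Real.sqrt (β / (β + 3 * L)))

/-- `X`, `Y`, `ε` are sequences generated by the algorithm with extrapolation parameters
`α k ∈ [0, αbar]`. Since the iterate before `X 0` is `X 0` itself, `Y 0 = X 0`. -/
structure IsGenerated {m n : ℕ} (f : Matrix (Fin m) (Fin n) ℝ → ℝ) (lam p β μ αbar : ℝ)
    (α : ℕ → ℝ) (X Y : ℕ → Matrix (Fin m) (Fin n) ℝ) (ε : ℕ → Fin m → ℝ) : Prop where
  alpha_mem : ∀ k, α k ∈ Set.Icc 0 αbar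
  eps_pos : ∀ i, 0 < ε 0 i
  eps_antitone : Antitone (ε 0)
  extrapolate_zero : Y 0 = X 0
  extrapolate_succ : ∀ k, Y (k + 1) = X (k + 1) + α (k + 1) • (X (k + 1) - X k)
  minimize : ∀ k Z, surrogate f lam p β (X k) (Y k) (ε k) (X (k + 1))
    ≤ surrogate f lam p β (X k) (Y k) (ε k) Z
  update : ∀ k, IsPerturbationUpdate μ (X k) (X (k + 1)) (ε k) (ε (k + 1))

/-- `C` bounds all singular values of the matrices `(Xₖ + Yₖ)/2 - ∇f(Yₖ)/(2β)`. -/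
def IsProxBound {m n : ℕ} (f : Matrix (Fin m) (Fin n) ℝ → ℝ) (β : ℝ)
    (X Y : ℕ → Matrix (Fin m) (Fin n) ℝ) (C : ℝ) : Prop :=
  ∀ k i, sv ((1 / 2 : ℝ) • (X k + Y k) - (1 / (2 * β)) • grad f (Y k)) i ≤ C

/-- `Xlim` is a limit point of the sequence `X`: some subsequence converges to it. -/
def IsLimitPoint {m n : ℕ} (X : ℕ → Matrix (Fin m) (Fin n) ℝ)
    (Xlim : Matrix (Fin m) (Fin n) ℝ) : Prop :=
  ∃ φ : ℕ → ℕ, StrictMono φ ∧ Tendsto (fun j => ‖X (φ j) - Xlim‖) atTop (𝓝 0)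

end

end EIRNRI

/-!
The rank of the iterates is identified without solving the subproblem in closed form. Singular
values come in decreasing order, so `I(X)` consists of the first `rank X` indices, and only the
last positive singular value has to be controlled.

*Boundedness.* Minimality of `X (k + 1)` against `X k`, the descent lemma for `f` and the tangent
line bound for the concave function `t ↦ tᵖ` show that the perturbed objective plus `β/2` times the
squared last step is nonincreasing (`potential_le_of_minimizer`). It dominates the objective, so
the iterates stay in a sublevel set and are bounded (`IsGenerated.exists_norm_le`); the gradient
being Lipschitz, the proximal points `(X + Y)/2 - ∇f(Y)/(2β)` are bounded too, which gives the
constant.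

*A gap for the last positive singular value.* Let `σ = σ_r(X (k + 1)) > 0` with
`r = rank (X (k + 1))`, and let `σ u vᵀ` be the last term of a singular value decomposition.
Subtracting it turns the `r`-th singular value into `0` and increases none of the others
(`exists_deflation`), so it lowers the weighted sum by at least `w_r σ`. Comparing the surrogate
at the two matrices gives `lam w_r ≤ β (2 ⟨u vᵀ, M⟩ - σ) ≤ 2 β C₁`, where `M` is the proximal point.
Solved for the base of the power `w_r`, this reads `σ_r(X k) + ε_r ≥ δ`, with `δ` the threshold of
the theorem (`svThreshold_le_of_minimizer`). Neither a trace inequality nor any ordering of the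
weights is needed.

*Identification.* The update keeps `ε` positive and nonincreasing, and multiplies `ε_i` by at most
`μ` whenever `i` is a positive index of the new iterate. Let `r` be a value that the rank takes
infinitely often. Then `ε_r → 0`, and once `ε_r < δ`, the gap shows that an iterate of rank `r` is
preceded by one of rank at least `r`. For the largest such `r` the rank is eventually at most `r`;
going backwards from the infinitely many iterates of rank `r`, all late iterates have rank `r`
(`exists_eventually_eq_of_backward`). In the limit the gap becomes `σ_r ≥ δ` by Weyl's inequality,
and the singular values after the `r`-th vanish.
-/

/-! ### Singular values under comparison and deflation -/

namespace LinearMap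

open Module InnerProductSpace

variable {E F : Type*} [NormedAddCommGroup E] [InnerProductSpace ℝ E] [FiniteDimensional ℝ E]
  [NormedAddCommGroup F] [InnerProductSpace ℝ F] [FiniteDimensional ℝ F]

/-- An orthonormal basis of right singular vectors of `T`, in the order of the singular values. -/
noncomputable def rightSingularBasis (T : E →ₗ[ℝ] F) :
    OrthonormalBasis (Fin (finrank ℝ E)) ℝ E :=
  T.isSymmetric_adjoint_comp_self.eigenvectorBasis rfl

theorem adjoint_apply_rightSingularBasis (T : E →ₗ[ℝ] F) (j : Fin (finrank ℝ E)) :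
    adjoint T (T (T.rightSingularBasis j)) = T.singularValues j ^ 2 • T.rightSingularBasis j := by
  have h := T.isSymmetric_adjoint_comp_self.apply_eigenvectorBasis rfl j
  rw [T.sq_singularValues_fin rfl j]
  exact h

theorem inner_apply_rightSingularBasis (T : E →ₗ[ℝ] F) (j : Fin (finrank ℝ E)) (x : E) :
    ⟪T (T.rightSingularBasis j), T x⟫_ℝ
      = T.singularValues j ^ 2 * ⟪T.rightSingularBasis j, x⟫_ℝ := by
  rw [← adjoint_inner_left, adjoint_apply_rightSingularBasis, real_inner_smul_left]

theorem norm_apply_rightSingularBasis (T : E →ₗ[ℝ] F) (j : Fin (finrank ℝ E)) :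
    ‖T (T.rightSingularBasis j)‖ = T.singularValues j := by
  have h := T.inner_apply_rightSingularBasis j (T.rightSingularBasis j)
  rw [real_inner_self_eq_norm_sq, real_inner_self_eq_norm_sq, T.rightSingularBasis.norm_eq_one]
    at h
  exact (sq_eq_sq₀ (norm_nonneg _) (T.singularValues_nonneg _)).1 (by linarith)

theorem norm_apply_sq_eq_sum (T : E →ₗ[ℝ] F) (x : E) :
    ‖T x‖ ^ 2 = ∑ j : Fin (finrank ℝ E),
      T.singularValues j ^ 2 * ⟪T.rightSingularBasis j, x⟫_ℝ ^ 2 := by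
  have h : ‖T x‖ ^ 2 = ⟪adjoint T (T x), x⟫_ℝ := by
    rw [adjoint_inner_left, real_inner_self_eq_norm_sq]
  rw [h, ← T.rightSingularBasis.sum_inner_mul_inner]
  refine Finset.sum_congr rfl fun j _ => ?_
  rw [adjoint_inner_left, real_inner_comm, inner_apply_rightSingularBasis]
  ring

/-- On vectors without components along the later right singular vectors, `T` stretches by at least
the `i`-th singular value. -/
theorem singularValues_mul_norm_le (T : E →ₗ[ℝ] F) {i : ℕ} {x : E}
    (hx : ∀ j : Fin (finrank ℝ E), i < j → ⟪T.rightSingularBasis j, x⟫_ℝ = 0) :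
    T.singularValues i * ‖x‖ ≤ ‖T x‖ := by
  refine (sq_le_sq₀ (mul_nonneg (T.singularValues_nonneg _) (norm_nonneg _)) (norm_nonneg _)).1 ?_
  rw [norm_apply_sq_eq_sum, mul_pow, ← T.rightSingularBasis.sum_sq_norm_inner_right,
    Finset.mul_sum]
  refine Finset.sum_le_sum fun j _ => ?_
  rw [Real.norm_eq_abs, sq_abs]
  rcases lt_or_ge i (j : ℕ) with h | h
  · simp [hx j h]
  · gcongr
    · exact T.singularValues_nonneg _
    · exact T.singularValues_antitone h

/-- On vectors without components along the earlier right singular vectors, `T` stretches by at most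
the `i`-th singular value. -/
theorem norm_apply_le_singularValues_mul (T : E →ₗ[ℝ] F) {i : ℕ} {x : E}
    (hx : ∀ j : Fin (finrank ℝ E), (j : ℕ) < i → ⟪T.rightSingularBasis j, x⟫_ℝ = 0) :
    ‖T x‖ ≤ T.singularValues i * ‖x‖ := by
  refine (sq_le_sq₀ (norm_nonneg _) (mul_nonneg (T.singularValues_nonneg _) (norm_nonneg _))).1 ?_
  rw [norm_apply_sq_eq_sum, mul_pow, ← T.rightSingularBasis.sum_sq_norm_inner_right,
    Finset.mul_sum]
  refine Finset.sum_le_sum fun j _ => ?_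
  rw [Real.norm_eq_abs, sq_abs]
  rcases lt_or_ge (j : ℕ) i with h | h
  · simp [hx j h]
  · gcongr
    · exact T.singularValues_nonneg _
    · exact T.singularValues_antitone h

theorem norm_apply_le_singularValues_zero_mul (T : E →ₗ[ℝ] F) (x : E) :
    ‖T x‖ ≤ T.singularValues 0 * ‖x‖ :=
  T.norm_apply_le_singularValues_mul fun _ h => absurd h (Nat.not_lt_zero _)

/-- Singular values are monotone in the map, up to a perturbation: for `c = 0` this compares two
maps one of which dominates the other pointwise in norm, and for `c = ‖S - T‖` it is Weyl's
inequality. -/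
theorem singularValues_le_add_of_norm_le (S T : E →ₗ[ℝ] F) {c : ℝ} (hc : 0 ≤ c)
    (h : ∀ x, ‖S x‖ ≤ ‖T x‖ + c * ‖x‖) (i : ℕ) :
    S.singularValues i ≤ T.singularValues i + c := by
  rcases le_or_gt (finrank ℝ E) i with hi | hi
  · rw [S.singularValues_of_finrank_le hi]
    exact add_nonneg (T.singularValues_nonneg _) hc
  -- The first `i + 1` right singular vectors of `S` span a space too large to avoid the orthogonal
  -- complement of the first `i` right singular vectors of `T`.
  let e : Fin (i + 1) → E := fun j => S.rightSingularBasis (Fin.castLE hi j)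
  let G : (Fin (i + 1) → ℝ) →ₗ[ℝ] E := Fintype.linearCombination ℝ e
  let P : (Fin (i + 1) → ℝ) →ₗ[ℝ] (Fin i → ℝ) :=
    LinearMap.pi fun j => (innerₛₗ ℝ (T.rightSingularBasis (Fin.castLE hi.le j))).comp G
  have hP : LinearMap.ker P ≠ ⊥ := P.ker_ne_bot_of_finrank_lt (by simp)
  obtain ⟨a, haP, ha0⟩ := (Submodule.ne_bot_iff _).1 hP
  have hon : Orthonormal ℝ e :=
    S.rightSingularBasis.orthonormal.comp _ (Fin.castLE_injective hi)
  have hG : G a = ∑ j, a j • e j := Fintype.linearCombination_apply ..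
  have hx0 : G a ≠ 0 := fun h0 => ha0 <| funext fun j => by
    have := hon.inner_right_fintype a j
    rw [← hG, h0, inner_zero_right] at this
    simpa using this.symm
  have h1 : S.singularValues i * ‖G a‖ ≤ ‖S (G a)‖ := by
    refine S.singularValues_mul_norm_le fun j hj => ?_
    rw [hG, inner_sum]
    refine Finset.sum_eq_zero fun l _ => ?_
    rw [real_inner_smul_right, S.rightSingularBasis.inner_eq_zero, mul_zero]
    intro hjl
    have := congrArg Fin.val hjl
    have hl := l.isLt
    simp at this
    omega
  have h2 : ‖T (G a)‖ ≤ T.singularValues i * ‖G a‖ := by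
    refine T.norm_apply_le_singularValues_mul fun j hj => ?_
    exact congrFun (LinearMap.mem_ker.1 haP) ⟨j, hj⟩
  have h3 := h (G a)
  exact le_of_mul_le_mul_right (by linarith) (norm_pos_iff.2 hx0)

/-- Removing the contribution of the `j`-th right singular vector does not increase the norm of any
value: the removed part is orthogonal to the rest. -/
theorem norm_apply_sub_inner_smul_le (T : E →ₗ[ℝ] F) (j : Fin (finrank ℝ E)) (x : E) :
    ‖T x - ⟪T.rightSingularBasis j, x⟫_ℝ • T (T.rightSingularBasis j)‖ ≤ ‖T x‖ := by
  refine (sq_le_sq₀ (norm_nonneg _) (norm_nonneg _)).1 ?_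
  rw [norm_sub_sq_real, real_inner_smul_right, real_inner_comm (T _) (T x),
    inner_apply_rightSingularBasis, norm_smul, norm_apply_rightSingularBasis, mul_pow,
    Real.norm_eq_abs, sq_abs]
  nlinarith [mul_nonneg (sq_nonneg (T.singularValues j)) (sq_nonneg ⟪T.rightSingularBasis j, x⟫_ℝ)]

/-- Removing the contribution of a right singular vector with positive singular value lowers the
rank. -/
theorem finrank_range_lt_of_apply_eq_sub (S T : E →ₗ[ℝ] F) (j : Fin (finrank ℝ E))
    (hj : 0 < T.singularValues j)
    (hS : ∀ x, S x = T x - ⟪T.rightSingularBasis j, x⟫_ℝ • T (T.rightSingularBasis j)) :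
    finrank ℝ (range S) < finrank ℝ (range T) := by
  have hker : ker T < ker S := by
    refine lt_of_le_of_ne (fun x hx => ?_) fun h => ?_
    · have hx' : T x = 0 := hx
      have h0 := T.inner_apply_rightSingularBasis j x
      rw [hx', inner_zero_right] at h0
      have : ⟪T.rightSingularBasis j, x⟫_ℝ = 0 := by
        rcases mul_eq_zero.1 h0.symm with h | h
        · exact absurd h (by positivity)
        · exact h
      rw [mem_ker, hS, hx', this]
      simp
    · have hv : T.rightSingularBasis j ∈ ker S := by
        rw [mem_ker, hS, real_inner_self_eq_norm_sq, T.rightSingularBasis.norm_eq_one]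
        simp
      rw [← h, mem_ker] at hv
      have := T.norm_apply_rightSingularBasis j
      rw [hv, norm_zero] at this
      exact hj.ne this
  have h1 := Submodule.finrank_lt_finrank_of_lt hker
  have h2 := S.finrank_range_add_finrank_ker
  have h3 := T.finrank_range_add_finrank_ker
  omega

end LinearMap

namespace EIRNRI

variable {m n : ℕ}

/-! ### The Frobenius inner product and smooth functions -/

/-- The Frobenius inner product `⟨A, B⟩ = tr(Aᵀ B)`. -/
noncomputable def frobeniusInner (A B : Matrix (Fin m) (Fin n) ℝ) : ℝ :=
  (A.transpose * B).trace

theorem frobeniusInner_eq_sum (A B : Matrix (Fin m) (Fin n) ℝ) :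
    frobeniusInner A B = ∑ i, ∑ j, A i j * B i j := by
  rw [frobeniusInner, Matrix.trace, Finset.sum_comm]
  simp [Matrix.mul_apply]

theorem frobeniusInner_comm (A B : Matrix (Fin m) (Fin n) ℝ) :
    frobeniusInner A B = frobeniusInner B A := by
  simp only [frobeniusInner_eq_sum, mul_comm]

theorem frobeniusInner_add_left (A B C : Matrix (Fin m) (Fin n) ℝ) :
    frobeniusInner (A + B) C = frobeniusInner A C + frobeniusInner B C := by
  simp [frobeniusInner, Matrix.add_mul]

theorem frobeniusInner_sub_left (A B C : Matrix (Fin m) (Fin n) ℝ) :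
    frobeniusInner (A - B) C = frobeniusInner A C - frobeniusInner B C := by
  simp [frobeniusInner, Matrix.sub_mul]

theorem frobeniusInner_sub_right (A B C : Matrix (Fin m) (Fin n) ℝ) :
    frobeniusInner A (B - C) = frobeniusInner A B - frobeniusInner A C := by
  simp [frobeniusInner, Matrix.mul_sub]

theorem frobeniusInner_smul_left (c : ℝ) (A B : Matrix (Fin m) (Fin n) ℝ) :
    frobeniusInner (c • A) B = c * frobeniusInner A B := by
  simp [frobeniusInner]

theorem norm_sq_eq_frobeniusInner (A : Matrix (Fin m) (Fin n) ℝ) :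
    ‖A‖ ^ 2 = frobeniusInner A A := by
  rw [Matrix.frobenius_norm_def, ← Real.sqrt_eq_rpow, Real.sq_sqrt (by positivity),
    frobeniusInner_eq_sum]
  simp [sq]

theorem norm_sub_sq_frobenius (A B : Matrix (Fin m) (Fin n) ℝ) :
    ‖A - B‖ ^ 2 = ‖A‖ ^ 2 - 2 * frobeniusInner B A + ‖B‖ ^ 2 := by
  simp only [norm_sq_eq_frobeniusInner, frobeniusInner_sub_left, frobeniusInner_sub_right]
  rw [frobeniusInner_comm A B]
  ring

theorem abs_frobeniusInner_le (A B : Matrix (Fin m) (Fin n) ℝ) :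
    |frobeniusInner A B| ≤ ‖A‖ * ‖B‖ := by
  refine abs_le_of_sq_le_sq ?_ (by positivity)
  rw [mul_pow, norm_sq_eq_frobeniusInner, norm_sq_eq_frobeniusInner]
  simp only [frobeniusInner_eq_sum, ← Finset.sum_product', ← sq]
  exact Finset.sum_mul_sq_le_sq_mul_sq _ (fun x : Fin m × Fin n => A x.1 x.2) _

theorem fderiv_eq_frobeniusInner_grad (f : Matrix (Fin m) (Fin n) ℝ → ℝ)
    (X Z : Matrix (Fin m) (Fin n) ℝ) : fderiv ℝ f X Z = frobeniusInner Z (grad f X) := by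
  conv_lhs => rw [Matrix.matrix_eq_sum_single Z]
  rw [map_sum, frobeniusInner_eq_sum]
  refine Finset.sum_congr rfl fun i _ => ?_
  rw [map_sum]
  refine Finset.sum_congr rfl fun j _ => ?_
  have : Matrix.single i j (Z i j) = Z i j • Matrix.single i j (1 : ℝ) := by
    simp [Matrix.smul_single]
  rw [this, map_smul]
  rfl

theorem hasDerivAt_comp_line {f : Matrix (Fin m) (Fin n) ℝ → ℝ} (hf : Differentiable ℝ f)
    (Y D : Matrix (Fin m) (Fin n) ℝ) (t : ℝ) :
    HasDerivAt (fun s : ℝ => f (Y + s • D)) (frobeniusInner D (grad f (Y + t • D))) t := by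
  rw [← fderiv_eq_frobeniusInner_grad]
  have h1 : HasDerivAt (fun s : ℝ => Y + s • D) D t := by
    have h := ((hasDerivAt_id t).smul_const D).const_add Y
    rwa [one_smul] at h
  exact (hf (Y + t • D)).hasFDerivAt.comp_hasDerivAt t h1

/-- The descent lemma: a function with `L`-Lipschitz gradient deviates from its linearisation by at
most `L/2` times the squared distance. -/
theorem IsLSmooth.abs_sub_linear_le {f : Matrix (Fin m) (Fin n) ℝ → ℝ} {L : ℝ}
    (hf : IsLSmooth f L) (X Y : Matrix (Fin m) (Fin n) ℝ) :
    |f X - f Y - frobeniusInner (X - Y) (grad f Y)| ≤ L / 2 * ‖X - Y‖ ^ 2 := by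
  obtain ⟨hd, hL, hlip⟩ := hf
  set D := X - Y with hD
  set g := frobeniusInner D (grad f Y) with hg
  have hderiv (t : ℝ) : HasDerivAt (fun s : ℝ => f (Y + s • D) - f Y - s * g)
      (frobeniusInner D (grad f (Y + t • D)) - g) t := by
    have h := ((hasDerivAt_comp_line hd Y D t).sub_const (f Y)).sub
      ((hasDerivAt_id t).mul_const g)
    rwa [one_mul] at h
  have hB (t : ℝ) : HasDerivAt (fun s : ℝ => L / 2 * ‖D‖ ^ 2 * s ^ 2) (L * t * ‖D‖ ^ 2) t := by
    convert! (hasDerivAt_pow 2 t).const_mul (L / 2 * ‖D‖ ^ 2) using 1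
    push_cast
    ring
  have hmain := image_norm_le_of_norm_deriv_right_le_deriv_boundary (a := 0) (b := 1)
    (fun t _ => (hderiv t).continuousAt.continuousWithinAt)
    (fun t _ => (hderiv t).hasDerivWithinAt) (by simp) hB ?_ (Set.right_mem_Icc.2 zero_le_one)
  · simpa [hD] using hmain
  · intro t ht
    rw [Real.norm_eq_abs, hg, ← frobeniusInner_sub_right]
    calc _ ≤ ‖D‖ * ‖grad f (Y + t • D) - grad f Y‖ := abs_frobeniusInner_le _ _
      _ ≤ ‖D‖ * (L * ‖Y + t • D - Y‖) := by gcongr; exact hlip _ _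
      _ = L * t * ‖D‖ ^ 2 := by
        rw [add_sub_cancel_left, norm_smul, Real.norm_of_nonneg ht.1]
        ring

theorem add_linear_le_of_convexOn {f : Matrix (Fin m) (Fin n) ℝ → ℝ} (hd : Differentiable ℝ f)
    (hc : ConvexOn ℝ Set.univ f) (X Y : Matrix (Fin m) (Fin n) ℝ) :
    f Y + frobeniusInner (X - Y) (grad f Y) ≤ f X := by
  have hline : ConvexOn ℝ Set.univ (fun s : ℝ => f (Y + s • (X - Y))) := by
    have := hc.comp_affineMap (AffineMap.lineMap Y X : ℝ →ᵃ[ℝ] Matrix (Fin m) (Fin n) ℝ)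
    rw [Set.preimage_univ] at this
    have he : (fun s : ℝ => f (Y + s • (X - Y))) = f ∘ AffineMap.lineMap Y X := by
      funext s
      exact congrArg f (by simp [AffineMap.lineMap_apply, add_comm])
    rwa [he]
  have h0 := hasDerivAt_comp_line hd Y (X - Y) 0
  have h := hline.deriv_le_slope (Set.mem_univ 0) (Set.mem_univ 1) zero_lt_one
    h0.differentiableAt
  rw [h0.deriv, slope_def_field] at h
  simp at h
  linarith

/-- In both cases of admissibility there is a curvature `κ`, namely `0` in the convex and `L` in the
general case, for which `f` has the quadratic lower bounds and the extrapolation is short enough. -/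
theorem IsAdmissibleBound.exists_curvature {f : Matrix (Fin m) (Fin n) ℝ → ℝ} {L β αbar : ℝ}
    (h : IsAdmissibleBound f L β αbar) (hf : IsLSmooth f L) (hβ : L < β) :
    ∃ κ : ℝ, (β + κ) * αbar ^ 2 ≤ β ∧ 0 ≤ κ ∧ ∀ X Y,
      f Y + frobeniusInner (X - Y) (grad f Y) - κ / 2 * ‖X - Y‖ ^ 2 ≤ f X := by
  obtain ⟨h0, h | h⟩ := h
  · refine ⟨0, ?_, le_rfl, fun X Y => ?_⟩
    · have : αbar ^ 2 ≤ 1 := by nlinarith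
      nlinarith [hf.2.1]
    · have := add_linear_le_of_convexOn hf.1 h.1 X Y
      linarith
  · have hL := hf.2.1
    refine ⟨L, ?_, hL, fun X Y => ?_⟩
    · have h1 : αbar ^ 2 < β / (β + 3 * L) := by
        rwa [Real.lt_sqrt h0.le] at h
      rw [lt_div_iff₀ (by linarith)] at h1
      nlinarith [sq_nonneg αbar]
    · have := abs_le.1 (hf.abs_sub_linear_le X Y)
      linarith [this.1]

/-- The graph of the concave function `t ↦ tᵖ` lies below its tangent lines. -/
theorem rpow_le_tangent {a b p : ℝ} (ha : 0 < a) (hb : 0 ≤ b) (hp0 : 0 ≤ p) (hp1 : p ≤ 1) :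
    b ^ p ≤ a ^ p + p * a ^ (p - 1) * (b - a) := by
  have h := rpow_one_add_le_one_add_mul_self (s := b / a - 1)
    (by have := div_nonneg hb ha.le; linarith) hp0 hp1
  rw [add_sub_cancel, Real.div_rpow hb ha.le, div_le_iff₀ (by positivity)] at h
  refine h.trans_eq ?_
  rw [Real.rpow_sub_one ha.ne']
  field_simp

/-! ### Singular values of matrices -/

section SingularValues

open Module InnerProductSpace

theorem norm_toEuclideanLin_le (A : Matrix (Fin m) (Fin n) ℝ) (x : EuclideanSpace ℝ (Fin n)) :
    ‖Matrix.toEuclideanLin A x‖ ≤ ‖A‖ * ‖x‖ := by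
  have h := Matrix.frobenius_norm_mul A (Matrix.replicateCol Unit (x : Fin n → ℝ))
  rw [← Matrix.replicateCol_mulVec, Matrix.frobenius_norm_replicateCol,
    Matrix.frobenius_norm_replicateCol] at h
  simpa [Matrix.toLpLin_apply] using h

theorem sv_nonneg (X : Matrix (Fin m) (Fin n) ℝ) (i : Fin m) : 0 ≤ sv X i :=
  LinearMap.singularValues_nonneg _ _

theorem sv_sub_le (A B : Matrix (Fin m) (Fin n) ℝ) (i : Fin m) : sv A i - sv B i ≤ ‖A - B‖ := by
  have h := LinearMap.singularValues_le_add_of_norm_le (Matrix.toEuclideanLin A)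
    (Matrix.toEuclideanLin B) (norm_nonneg (A - B)) (fun x => ?_) i
  · exact sub_left_le_of_le_add h
  · have h1 := norm_toEuclideanLin_le (A - B) x
    rw [map_sub, LinearMap.sub_apply] at h1
    have h2 := norm_le_norm_add_norm_sub' (Matrix.toEuclideanLin A x) (Matrix.toEuclideanLin B x)
    linarith

/-- Weyl's inequality: each singular value is `1`-Lipschitz for the Frobenius norm. -/
theorem abs_sv_sub_le (A B : Matrix (Fin m) (Fin n) ℝ) (i : Fin m) :
    |sv A i - sv B i| ≤ ‖A - B‖ := by
  refine abs_sub_le_iff.2 ⟨sv_sub_le A B i, ?_⟩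
  rw [norm_sub_rev]
  exact sv_sub_le B A i

theorem sv_le_norm (A : Matrix (Fin m) (Fin n) ℝ) (i : Fin m) : sv A i ≤ ‖A‖ := by
  have h := sv_sub_le A 0 i
  have h0 : sv (0 : Matrix (Fin m) (Fin n) ℝ) i = 0 := by simp [sv]
  rwa [h0, sub_zero, sub_zero] at h

theorem rank_eq_finrank_range_toEuclideanLin (X : Matrix (Fin m) (Fin n) ℝ) :
    X.rank = finrank ℝ (LinearMap.range (Matrix.toEuclideanLin X)) := by
  rw [Matrix.toEuclideanLin, Matrix.toLpLin_eq_toLin]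
  exact X.rank_eq_finrank_range_toLin _ _

theorem sv_pos_iff (X : Matrix (Fin m) (Fin n) ℝ) (i : Fin m) :
    0 < sv X i ↔ (i : ℕ) < X.rank := by
  rw [rank_eq_finrank_range_toEuclideanLin]
  exact LinearMap.singularValues_pos_iff_lt_finrank_range _

theorem mem_posIdx (X : Matrix (Fin m) (Fin n) ℝ) (i : Fin m) :
    i ∈ posIdx X ↔ (i : ℕ) < X.rank := by
  simp [posIdx, sv_pos_iff]

theorem card_filter_val_lt {r : ℕ} (hr : r ≤ m) :
    (Finset.univ.filter fun i : Fin m => (i : ℕ) < r).card = r := by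
  rw [Fin.card_filter_val_lt, min_eq_right hr]

/-- The positive singular values come first, so their indices are determined by the rank. -/
theorem posIdx_eq_filter (X : Matrix (Fin m) (Fin n) ℝ) :
    posIdx X = Finset.univ.filter fun i : Fin m => (i : ℕ) < X.rank := by
  ext i
  simp [mem_posIdx]

theorem card_posIdx (X : Matrix (Fin m) (Fin n) ℝ) : (posIdx X).card = X.rank := by
  rw [posIdx_eq_filter, card_filter_val_lt X.rank_le_height]

theorem posIdx_ssubset_iff (X X' : Matrix (Fin m) (Fin n) ℝ) :
    posIdx X ⊂ posIdx X' ↔ X.rank < X'.rank := by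
  constructor
  · intro h
    rw [← card_posIdx, ← card_posIdx]
    exact Finset.card_lt_card h
  · intro h
    refine Finset.ssubset_iff_subset_ne.2 ⟨fun i hi => ?_, fun he => ?_⟩
    · rw [mem_posIdx] at hi ⊢
      exact hi.trans h
    · rw [← card_posIdx, ← card_posIdx, he] at h
      exact lt_irrefl _ h

theorem posIdx_eq_iff (X X' : Matrix (Fin m) (Fin n) ℝ) :
    posIdx X = posIdx X' ↔ X.rank = X'.rank := by
  constructor
  · intro h
    rw [← card_posIdx, ← card_posIdx, h]
  · intro h
    rw [posIdx_eq_filter, posIdx_eq_filter, h]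

/-- The outer product `u vᵀ`. -/
def outer (u : EuclideanSpace ℝ (Fin m)) (v : EuclideanSpace ℝ (Fin n)) :
    Matrix (Fin m) (Fin n) ℝ :=
  Matrix.of fun i j => u i * v j

theorem toEuclideanLin_outer (u : EuclideanSpace ℝ (Fin m)) (v x : EuclideanSpace ℝ (Fin n)) :
    Matrix.toEuclideanLin (outer u v) x = ⟪v, x⟫_ℝ • u := by
  ext i
  simp [outer, Matrix.toLpLin_apply, Matrix.mulVec, dotProduct, PiLp.inner_apply,
    Finset.sum_mul]
  exact Finset.sum_congr rfl fun j _ => by ring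

theorem frobeniusInner_outer (u : EuclideanSpace ℝ (Fin m)) (v : EuclideanSpace ℝ (Fin n))
    (M : Matrix (Fin m) (Fin n) ℝ) :
    frobeniusInner (outer u v) M = ⟪u, Matrix.toEuclideanLin M v⟫_ℝ := by
  rw [frobeniusInner_eq_sum]
  simp [outer, Matrix.toLpLin_apply, Matrix.mulVec, dotProduct, PiLp.inner_apply,
    Finset.sum_mul]
  exact Finset.sum_congr rfl fun i _ => Finset.sum_congr rfl fun j _ => by ring

/-- Deflation: subtracting the last term `D = s u vᵀ` of the singular value decomposition of `Z`
kills the last positive singular value `s` and does not increase the others. -/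
theorem exists_deflation (Z : Matrix (Fin m) (Fin n) ℝ) (i : Fin m) (hi : (i : ℕ) + 1 = Z.rank) :
    ∃ D : Matrix (Fin m) (Fin n) ℝ,
      frobeniusInner D Z = sv Z i ^ 2 ∧ ‖D‖ ^ 2 = sv Z i ^ 2 ∧
      (∀ l, sv (Z - D) l ≤ sv Z l) ∧ sv (Z - D) i = 0 ∧
      ∀ (M : Matrix (Fin m) (Fin n) ℝ) (C : ℝ), (∀ l, sv M l ≤ C) →
        frobeniusInner D M ≤ sv Z i * C := by
  have hin : (i : ℕ) < finrank ℝ (EuclideanSpace ℝ (Fin n)) := by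
    have := Z.rank_le_width
    rw [finrank_euclideanSpace_fin]
    omega
  have hpos : 0 < sv Z i := (sv_pos_iff Z i).2 (by omega)
  set T := Matrix.toEuclideanLin Z with hT
  set j : Fin (finrank ℝ (EuclideanSpace ℝ (Fin n))) := ⟨i, hin⟩ with hj
  set v := T.rightSingularBasis j with hv
  have hsv : ‖T v‖ = sv Z i := T.norm_apply_rightSingularBasis j
  have hv1 : ‖v‖ = 1 := T.rightSingularBasis.norm_eq_one j
  have happ (x : EuclideanSpace ℝ (Fin n)) :
      Matrix.toEuclideanLin (Z - outer (T v) v) x = T x - ⟪v, x⟫_ℝ • T v := by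
    rw [map_sub, LinearMap.sub_apply, toEuclideanLin_outer]
  refine ⟨outer (T v) v, ?_, ?_, fun l => ?_, ?_, fun M C hM => ?_⟩
  · rw [frobeniusInner_outer, real_inner_self_eq_norm_sq, hsv]
  · rw [norm_sq_eq_frobeniusInner, frobeniusInner_outer, toEuclideanLin_outer,
      real_inner_self_eq_norm_sq, hv1, real_inner_smul_right, real_inner_self_eq_norm_sq, hsv]
    ring
  · have h := LinearMap.singularValues_le_add_of_norm_le
      (Matrix.toEuclideanLin (Z - outer (T v) v)) T le_rfl (fun x => ?_) l
    · rwa [add_zero] at h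
    · rw [zero_mul, add_zero, happ]
      exact T.norm_apply_sub_inner_smul_le j x
  · have h := LinearMap.finrank_range_lt_of_apply_eq_sub _ T j hpos happ
    rw [← rank_eq_finrank_range_toEuclideanLin, hT, ← rank_eq_finrank_range_toEuclideanLin,
      ← hT] at h
    have h2 := (sv_pos_iff (Z - outer (T v) v) i).not.2 (by omega)
    exact le_antisymm (not_lt.1 h2) (sv_nonneg _ _)
  · rw [frobeniusInner_outer]
    have hM0 : (Matrix.toEuclideanLin M).singularValues 0 ≤ C := hM ⟨0, i.pos⟩
    calc _ ≤ ‖T v‖ * ‖Matrix.toEuclideanLin M v‖ := real_inner_le_norm _ _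
      _ ≤ sv Z i * ((Matrix.toEuclideanLin M).singularValues 0 * ‖v‖) := by
        rw [hsv]
        gcongr
        exact LinearMap.norm_apply_le_singularValues_zero_mul _ _
      _ ≤ sv Z i * C := by
        rw [hv1, mul_one]
        gcongr

end SingularValues

/-! ### Minimisers of the surrogate -/

theorem weight_nonneg {p : ℝ} (hp : 0 ≤ p) (X : Matrix (Fin m) (Fin n) ℝ) {ε : Fin m → ℝ}
    (hε : ∀ i, 0 ≤ ε i) (i : Fin m) : 0 ≤ weight p X ε i :=
  mul_nonneg hp (Real.rpow_nonneg (add_nonneg (sv_nonneg X i) (hε i)) _)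

/-- At a minimiser of the surrogate, the weight of the last positive singular value is bounded,
since otherwise deflation would lower the surrogate. -/
theorem lam_mul_weight_le_of_minimizer {f : Matrix (Fin m) (Fin n) ℝ → ℝ} {lam p β C : ℝ}
    (hlam : 0 ≤ lam) (hp : 0 ≤ p) (hβ : 0 < β) {X Y Z : Matrix (Fin m) (Fin n) ℝ} {ε : Fin m → ℝ}
    (hε : ∀ i, 0 ≤ ε i)
    (hmin : ∀ Z', surrogate f lam p β X Y ε Z ≤ surrogate f lam p β X Y ε Z')
    (hC : ∀ i, sv ((1 / 2 : ℝ) • (X + Y) - (1 / (2 * β)) • grad f Y) i ≤ C)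
    (i : Fin m) (hi : (i : ℕ) + 1 = Z.rank) :
    lam * weight p X ε i ≤ 2 * β * C := by
  obtain ⟨D, hDZ, hDD, hle, h0, hDM⟩ := exists_deflation Z i hi
  have hpos : 0 < sv Z i := (sv_pos_iff Z i).2 (by omega)
  have hM := hDM _ C hC
  have hmin' := hmin (Z - D)
  rw [surrogate, surrogate] at hmin'
  -- The linear term of the surrogate is a Frobenius inner product by definition.
  change _ + frobeniusInner Z _ + _ + _ + _ ≤ _ + frobeniusInner (Z - D) _ + _ + _ + _ at hmin'
  have hsum : ∑ l, weight p X ε l * sv (Z - D) l + weight p X ε i * sv Z i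
      ≤ ∑ l, weight p X ε l * sv Z l := by
    rw [← Finset.add_sum_erase _ _ (Finset.mem_univ i), h0,
      ← Finset.add_sum_erase _ (fun l => weight p X ε l * sv Z l) (Finset.mem_univ i)]
    have : ∑ l ∈ Finset.univ.erase i, weight p X ε l * sv (Z - D) l
        ≤ ∑ l ∈ Finset.univ.erase i, weight p X ε l * sv Z l :=
      Finset.sum_le_sum fun l _ => mul_le_mul_of_nonneg_left (hle l) (weight_nonneg hp X hε l)
    linarith
  -- Both proximal terms change by the same amount, and `⟨D, Z⟩ = ‖D‖² = σ²`; the linear terms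
  -- collect into the inner product of `D` with the proximal point.
  have hY : ‖Z - D - Y‖ ^ 2 = ‖Z - Y‖ ^ 2 - 2 * (sv Z i ^ 2 - frobeniusInner D Y) + sv Z i ^ 2 := by
    rw [sub_right_comm, norm_sub_sq_frobenius, frobeniusInner_sub_right, hDZ, hDD]
  have hX : ‖Z - D - X‖ ^ 2 = ‖Z - X‖ ^ 2 - 2 * (sv Z i ^ 2 - frobeniusInner D X) + sv Z i ^ 2 := by
    rw [sub_right_comm, norm_sub_sq_frobenius, frobeniusInner_sub_right, hDZ, hDD]
  have hMe : 2 * β * frobeniusInner D ((1 / 2 : ℝ) • (X + Y) - (1 / (2 * β)) • grad f Y)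
      = β * frobeniusInner D X + β * frobeniusInner D Y - frobeniusInner D (grad f Y) := by
    rw [frobeniusInner_comm D, frobeniusInner_sub_left, frobeniusInner_smul_left,
      frobeniusInner_smul_left, frobeniusInner_add_left, frobeniusInner_comm D X,
      frobeniusInner_comm D Y, frobeniusInner_comm D (grad f Y)]
    field_simp
  rw [hY, hX, frobeniusInner_sub_left] at hmin'
  have hM2 := mul_le_mul_of_nonneg_left hM (by positivity : 0 ≤ 2 * β)
  rw [hMe] at hM2
  have hsum2 := mul_le_mul_of_nonneg_left hsum hlam
  have key : lam * weight p X ε i * sv Z i ≤ 2 * β * C * sv Z i := by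
    nlinarith [mul_nonneg hβ.le (sq_nonneg (sv Z i))]
  exact le_of_mul_le_mul_right key hpos

/-- The lower bound on the singular values in the limit. -/
noncomputable def svThreshold (lam p β C : ℝ) : ℝ :=
  (lam * p / (2 * β * C)) ^ (1 / (1 - p))

/-- Solving the bound on the weight for its base: the perturbed singular value of the old iterate at
the last positive index of the new one stays above the threshold. -/
theorem svThreshold_le_of_minimizer {f : Matrix (Fin m) (Fin n) ℝ → ℝ} {lam p β C : ℝ}
    (hlam : 0 < lam) (hp0 : 0 < p) (hp1 : p < 1) (hβ : 0 < β) (hC0 : 0 < C)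
    {X Y Z : Matrix (Fin m) (Fin n) ℝ} {ε : Fin m → ℝ} (hε : ∀ i, 0 < ε i)
    (hmin : ∀ Z', surrogate f lam p β X Y ε Z ≤ surrogate f lam p β X Y ε Z')
    (hC : ∀ i, sv ((1 / 2 : ℝ) • (X + Y) - (1 / (2 * β)) • grad f Y) i ≤ C)
    (i : Fin m) (hi : (i : ℕ) + 1 = Z.rank) :
    svThreshold lam p β C ≤ sv X i + ε i := by
  have h := lam_mul_weight_le_of_minimizer hlam.le hp0.le hβ (fun i => (hε i).le) hmin hC i hi
  have ha : 0 < sv X i + ε i := add_pos_of_nonneg_of_pos (sv_nonneg X i) (hε i)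
  have hq : 0 < 1 - p := by linarith
  rw [weight, show p - 1 = -(1 - p) by ring, Real.rpow_neg ha.le] at h
  have h2 : lam * p / (2 * β * C) ≤ (sv X i + ε i) ^ (1 - p) := by
    have hb : 0 < (sv X i + ε i) ^ (1 - p) := Real.rpow_pos_of_pos ha _
    rw [div_le_iff₀ (by positivity)]
    rw [← mul_assoc, ← div_eq_mul_inv, div_le_iff₀ hb] at h
    linarith
  calc svThreshold lam p β C ≤ ((sv X i + ε i) ^ (1 - p)) ^ (1 / (1 - p)) :=
        Real.rpow_le_rpow (by positivity) h2 (by positivity)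
    _ = sv X i + ε i := by
        rw [← Real.rpow_mul ha.le, mul_one_div_cancel hq.ne', Real.rpow_one]

/-! ### The perturbation update -/

theorem exists_entry_eq (v : Fin m → ℝ) {j : ℕ} (h1 : 1 ≤ j) (hm : j ≤ m) :
    ∃ i : Fin m, (i : ℕ) + 1 = j ∧ entry v j = v i :=
  ⟨⟨j - 1, by omega⟩, by simp; omega, by rw [entry, dif_pos ⟨h1, hm⟩]⟩

theorem entry_pos {v : Fin m → ℝ} (hv : ∀ i, 0 < v i) {j : ℕ} (h1 : 1 ≤ j) (hm : j ≤ m) :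
    0 < entry v j := by
  obtain ⟨i, -, he⟩ := exists_entry_eq v h1 hm
  rw [he]
  exact hv i

theorem trim_le (μ : ℝ) (X' : Matrix (Fin m) (Fin n) ℝ) (ε ε' : Fin m → ℝ) (i : Fin m) :
    trim μ X' ε ε' i ≤ ε i := by
  unfold trim
  split_ifs
  exacts [le_rfl, min_le_left _ _]

theorem trim_pos {μ : ℝ} (hμ : 0 < μ) (X' : Matrix (Fin m) (Fin n) ℝ) {ε ε' : Fin m → ℝ}
    (hε : ∀ i, 0 < ε i) (hε' : ∀ i ∈ posIdx X', 0 < ε' i) (i : Fin m) :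
    0 < trim μ X' ε ε' i := by
  unfold trim
  split_ifs with h
  · exact hε i
  · refine lt_min (hε i) (mul_pos hμ ?_)
    push Not at h
    rw [card_posIdx] at h ⊢
    have h1 : 1 ≤ X'.rank := Nat.one_le_iff_ne_zero.2 h.1
    obtain ⟨l, hl, he⟩ := exists_entry_eq ε' h1 X'.rank_le_height
    obtain ⟨l', hl', he'⟩ := exists_entry_eq (sv X') h1 X'.rank_le_height
    rw [he, he']
    exact add_pos ((sv_pos_iff X' l').2 (by omega)) (hε' l ((mem_posIdx X' l).2 (by omega)))

/-- On the positive indices of the new iterate the update stays positive and contracts by `μ`. -/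
theorem IsPerturbationUpdate.pos_and_le_of_mem {μ : ℝ} {X X' : Matrix (Fin m) (Fin n) ℝ}
    {ε ε' : Fin m → ℝ} (h : IsPerturbationUpdate μ X X' ε ε') (hμ : 0 < μ) (hε : ∀ i, 0 < ε i)
    {i : Fin m} (hi : i ∈ posIdx X') : 0 < ε' i ∧ ε' i ≤ μ * ε i := by
  have hbase : ε' i = μ * ε i → 0 < ε' i ∧ ε' i ≤ μ * ε i := fun he =>
    ⟨he ▸ mul_pos hμ (hε i), he.le⟩
  rcases lt_trichotomy X'.rank X.rank with hr | hr | hr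
  · exact hbase ((h.1 ((posIdx_ssubset_iff _ _).2 hr)).1 i hi)
  · exact hbase ((h.2.2 ((posIdx_eq_iff _ _).2 hr.symm)).1 i hi)
  · obtain ⟨h1, h2, -⟩ := h.2.1 ((posIdx_ssubset_iff _ _).2 hr)
    by_cases hiX : i ∈ posIdx X
    · exact hbase (h1 i hiX)
    · rw [h2 i (Finset.mem_sdiff.2 ⟨hi, hiX⟩)]
      split_ifs with h0
      · exact ⟨mul_pos hμ (hε i), le_rfl⟩
      · refine ⟨mul_pos hμ (lt_min (hε i) ?_), mul_le_mul_of_nonneg_left (min_le_left _ _) hμ.le⟩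
        rw [card_posIdx] at h0 ⊢
        exact entry_pos hε (Nat.one_le_iff_ne_zero.2 h0) X.rank_le_height

/-- The update keeps the perturbation positive and does not increase it. -/
theorem IsPerturbationUpdate.pos_and_le {μ : ℝ} {X X' : Matrix (Fin m) (Fin n) ℝ}
    {ε ε' : Fin m → ℝ} (h : IsPerturbationUpdate μ X X' ε ε') (hμ : 0 < μ) (hμ1 : μ < 1)
    (hε : ∀ i, 0 < ε i) (i : Fin m) : 0 < ε' i ∧ ε' i ≤ ε i := by
  by_cases hi : i ∈ posIdx X'
  · obtain ⟨h1, h2⟩ := h.pos_and_le_of_mem hμ hε hi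
    exact ⟨h1, h2.trans (mul_le_of_le_one_left (hε i).le hμ1.le)⟩
  have htrim : ε' i = trim μ X' ε ε' i → 0 < ε' i ∧ ε' i ≤ ε i := fun he => by
    rw [he]
    exact ⟨trim_pos hμ X' hε (fun l hl => (h.pos_and_le_of_mem hμ hε hl).1) i,
      trim_le μ X' ε ε' i⟩
  rcases lt_trichotomy X'.rank X.rank with hr | hr | hr
  · obtain ⟨-, h2, h3⟩ := h.1 ((posIdx_ssubset_iff _ _).2 hr)
    by_cases hiX : i ∈ posIdx X
    · exact htrim (h2 i (Finset.mem_sdiff.2 ⟨hiX, hi⟩))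
    · rw [h3 i hiX]
      refine ⟨lt_min (hε i) ?_, min_le_left _ _⟩
      -- The last positive index of `X` is not a positive index of `X'`, so it was trimmed.
      rw [card_posIdx]
      obtain ⟨l, hl, he⟩ := exists_entry_eq ε' (by omega : 1 ≤ X.rank) X.rank_le_height
      have hmem : l ∈ posIdx X \ posIdx X' := by
        rw [Finset.mem_sdiff, mem_posIdx, mem_posIdx]
        omega
      rw [he, h2 l hmem]
      exact trim_pos hμ X' hε (fun l hl => (h.pos_and_le_of_mem hμ hε hl).1) l
  · exact htrim ((h.2.2 ((posIdx_eq_iff _ _).2 hr.symm)).2 i hi)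
  · exact htrim ((h.2.1 ((posIdx_ssubset_iff _ _).2 hr)).2.2 i hi)

/-! ### Two facts on sequences -/

/-- A nonnegative nonincreasing sequence that is contracted by a fixed factor infinitely often tends
to zero. -/
theorem tendsto_zero_of_frequently_contracted {a : ℕ → ℝ} {μ : ℝ} (hμ1 : μ < 1)
    (h0 : ∀ k, 0 ≤ a k) (hanti : Antitone a) (hfreq : ∃ᶠ k in atTop, a (k + 1) ≤ μ * a k) :
    Tendsto a atTop (𝓝 0) := by
  have hbdd : BddBelow (Set.range a) := ⟨0, by rintro _ ⟨k, rfl⟩; exact h0 k⟩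
  have hlim := tendsto_atTop_ciInf hanti hbdd
  set c := ⨅ k, a k
  have hc0 : 0 ≤ c := le_ciInf h0
  have hle : c ≤ μ * c := by
    refine ge_of_tendsto_of_frequently (b := c) (hlim.const_mul μ) (hfreq.mono fun k hk => ?_)
    exact (ciInf_le hbdd (k + 1)).trans hk
  have : c = 0 := by nlinarith
  rwa [this] at hlim

/-- If a bounded sequence of naturals eventually can only take its largest recurring value `r`
directly after having taken it, then it is eventually constant. -/
theorem exists_eventually_eq_of_backward {u : ℕ → ℕ} {M : ℕ} (hM : ∀ k, u k ≤ M)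
    (hback : ∀ r, (∃ᶠ k in atTop, u k = r) → ∀ᶠ k in atTop, u (k + 1) = r → r ≤ u k) :
    ∃ r, ∀ᶠ k in atTop, u k = r := by
  classical
  have hex : ∃ r ≤ M, ∃ᶠ k in atTop, u k = r := by
    by_contra! hno
    have : ∀ᶠ k in atTop, ∀ r ∈ Finset.range (M + 1), u k ≠ r := by
      rw [Finset.eventually_all]
      intro r hr
      exact hno r (by simpa [Nat.lt_succ_iff] using hr)
    obtain ⟨k, hk⟩ := this.exists
    exact hk (u k) (Finset.mem_range.2 (Nat.lt_succ_of_le (hM k))) rfl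
  obtain ⟨r₀, hr₀M, hr₀⟩ := hex
  set r := Nat.findGreatest (fun r => ∃ᶠ k in atTop, u k = r) M
  have hr : ∃ᶠ k in atTop, u k = r := Nat.findGreatest_spec (P := fun r => ∃ᶠ k in atTop, u k = r)
    hr₀M hr₀
  have hle : ∀ᶠ k in atTop, u k ≤ r := by
    have : ∀ᶠ k in atTop, ∀ s ∈ Finset.Ioc r M, u k ≠ s := by
      rw [Finset.eventually_all]
      intro s hs
      rw [Finset.mem_Ioc] at hs
      exact not_frequently.1 (Nat.findGreatest_is_greatest hs.1 hs.2)
    filter_upwards [this] with k hk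
    by_contra! hlt
    exact hk (u k) (Finset.mem_Ioc.2 ⟨hlt, hM k⟩) rfl
  obtain ⟨K, hK⟩ := eventually_atTop.1 (hle.and (hback r hr))
  refine ⟨r, eventually_atTop.2 ⟨K, fun k hk => ?_⟩⟩
  -- Go backwards to `k` from a later time at which the value `r` is taken.
  obtain ⟨N, hN, hNr⟩ := frequently_atTop.1 hr k
  induction N, hN using Nat.le_induction with
  | base => exact hNr
  | succ N hN ih =>
    have h := hK N (hk.trans hN)
    exact ih (le_antisymm h.1 (h.2 hNr))

/-! ### Descent and boundedness -/

/-- The Lyapunov function of the iteration: the objective with perturbed singular values, plus the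
squared length of the last step. -/
noncomputable def potential (f : Matrix (Fin m) (Fin n) ℝ → ℝ) (lam p β : ℝ)
    (Xprev X : Matrix (Fin m) (Fin n) ℝ) (ε : Fin m → ℝ) : ℝ :=
  f X + lam * ∑ i, (sv X i + ε i) ^ p + β / 2 * ‖X - Xprev‖ ^ 2

theorem objective_le_potential {f : Matrix (Fin m) (Fin n) ℝ → ℝ} {lam p β : ℝ} (hlam : 0 ≤ lam)
    (hp : 0 ≤ p) (hβ : 0 ≤ β) (Xprev X : Matrix (Fin m) (Fin n) ℝ) {ε : Fin m → ℝ}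
    (hε : ∀ i, 0 ≤ ε i) : objective f lam p X ≤ potential f lam p β Xprev X ε := by
  have hsum : ∑ i, sv X i ^ p ≤ ∑ i, (sv X i + ε i) ^ p :=
    Finset.sum_le_sum fun i _ =>
      Real.rpow_le_rpow (sv_nonneg X i) (le_add_of_nonneg_right (hε i)) hp
  have h1 := mul_le_mul_of_nonneg_left hsum hlam
  have h2 : 0 ≤ β / 2 * ‖X - Xprev‖ ^ 2 := by positivity
  rw [objective, potential]
  linarith

/-- One step of the iteration does not increase the potential. -/
theorem potential_le_of_minimizer {f : Matrix (Fin m) (Fin n) ℝ → ℝ} {L κ lam p β a : ℝ}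
    (hlam : 0 ≤ lam) (hp0 : 0 ≤ p) (hp1 : p ≤ 1) (hβ : L ≤ β) (hf : IsLSmooth f L)
    (hκ : ∀ X Y, f Y + frobeniusInner (X - Y) (grad f Y) - κ / 2 * ‖X - Y‖ ^ 2 ≤ f X)
    (ha : (β + κ) * a ^ 2 ≤ β) {Xprev X Y X' : Matrix (Fin m) (Fin n) ℝ} {ε ε' : Fin m → ℝ}
    (hY : Y = X + a • (X - Xprev))
    (hε : ∀ i, 0 < ε i) (hε' : ∀ i, 0 < ε' i ∧ ε' i ≤ ε i)
    (hmin : surrogate f lam p β X Y ε X' ≤ surrogate f lam p β X Y ε X) :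
    potential f lam p β X X' ε' ≤ potential f lam p β Xprev X ε := by
  have htan : ∑ i, (sv X' i + ε' i) ^ p
      ≤ ∑ i, (sv X i + ε i) ^ p
        + (∑ i, weight p X ε i * sv X' i - ∑ i, weight p X ε i * sv X i) := by
    rw [← Finset.sum_sub_distrib, ← Finset.sum_add_distrib]
    refine Finset.sum_le_sum fun i _ => ?_
    have h1 : (sv X' i + ε' i) ^ p ≤ (sv X' i + ε i) ^ p :=
      Real.rpow_le_rpow (add_nonneg (sv_nonneg _ _) (hε' i).1.le) (by linarith [(hε' i).2]) hp0
    have h2 := rpow_le_tangent (add_pos_of_nonneg_of_pos (sv_nonneg X i) (hε i))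
      (add_nonneg (sv_nonneg X' i) (hε i).le) hp0 hp1
    rw [weight]
    linarith
  have htan2 := mul_le_mul_of_nonneg_left htan hlam
  have hup := (abs_le.1 (hf.abs_sub_linear_le X' Y)).2
  have hlow := hκ X Y
  have hXY : ‖X - Y‖ ^ 2 = a ^ 2 * ‖X - Xprev‖ ^ 2 := by
    rw [hY, norm_sub_rev, add_sub_cancel_left, norm_smul, mul_pow, Real.norm_eq_abs, sq_abs]
  -- The choice of `a` absorbs the extrapolation error into the previous step; the surplus
  -- `(β - L)/2 ‖X' - Y‖²` is dropped.
  have hstep := mul_le_mul_of_nonneg_right ha (sq_nonneg ‖X - Xprev‖)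
  have hdrop := mul_nonneg (sub_nonneg.2 hβ) (sq_nonneg ‖X' - Y‖)
  rw [surrogate, surrogate] at hmin
  change _ + frobeniusInner X' _ + _ + _ + _ ≤ _ + frobeniusInner X _ + _ + _ + _ at hmin
  rw [sub_self, norm_zero, hXY] at hmin
  rw [frobeniusInner_sub_left] at hup hlow
  rw [hXY] at hlow
  rw [potential, potential]
  nlinarith

section Generated

variable {f : Matrix (Fin m) (Fin n) ℝ → ℝ} {L lam p β μ αbar : ℝ} {α : ℕ → ℝ}
  {X Y : ℕ → Matrix (Fin m) (Fin n) ℝ} {ε : ℕ → Fin m → ℝ}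

theorem IsGenerated.eps_pos_all (h : IsGenerated f lam p β μ αbar α X Y ε) (hμ0 : 0 < μ)
    (hμ1 : μ < 1) (k : ℕ) : ∀ i, 0 < ε k i := by
  induction k with
  | zero => exact h.eps_pos
  | succ k ih => exact fun i => ((h.update k).pos_and_le hμ0 hμ1 ih i).1

theorem IsGenerated.antitone_eps (h : IsGenerated f lam p β μ αbar α X Y ε) (hμ0 : 0 < μ)
    (hμ1 : μ < 1) (i : Fin m) : Antitone fun k => ε k i :=
  antitone_nat_of_succ_le fun k =>
    ((h.update k).pos_and_le hμ0 hμ1 (h.eps_pos_all hμ0 hμ1 k) i).2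

/-- The extrapolation rule for all `k`: truncated subtraction makes the iterate before `X 0` equal
to `X 0`. -/
theorem IsGenerated.extrapolate (h : IsGenerated f lam p β μ αbar α X Y ε) (k : ℕ) :
    Y k = X k + α k • (X k - X (k - 1)) := by
  cases k with
  | zero => simp [h.extrapolate_zero]
  | succ k => exact h.extrapolate_succ k

theorem IsGenerated.exists_norm_le (h : IsGenerated f lam p β μ αbar α X Y ε)
    (hlam : 0 < lam) (hp0 : 0 < p) (hp1 : p < 1) (hβ : L < β) (hμ0 : 0 < μ) (hμ1 : μ < 1)
    (hsmooth : IsLSmooth f L) (hlevel : IsLevelBounded (objective f lam p))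
    (hαbar : IsAdmissibleBound f L β αbar) : ∃ R, ∀ k, ‖X k‖ ≤ R := by
  obtain ⟨κ, hκα, hκ0, hκ⟩ := hαbar.exists_curvature hsmooth hβ
  have hβ0 : 0 ≤ β := hsmooth.2.1.trans hβ.le
  have hanti : Antitone fun k => potential f lam p β (X (k - 1)) (X k) (ε k) := by
    refine antitone_nat_of_succ_le fun k => ?_
    obtain ⟨hα0, hα1⟩ := h.alpha_mem k
    refine potential_le_of_minimizer hlam.le hp0.le hp1.le hβ.le hsmooth hκ ?_
      (h.extrapolate k) (h.eps_pos_all hμ0 hμ1 k)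
      (fun i => (h.update k).pos_and_le hμ0 hμ1 (h.eps_pos_all hμ0 hμ1 k) i)
      (h.minimize k (X k))
    refine le_trans ?_ hκα
    gcongr
  obtain ⟨R, hR⟩ := hlevel (potential f lam p β (X (0 - 1)) (X 0) (ε 0))
  refine ⟨R, fun k => hR _ ?_⟩
  exact (objective_le_potential hlam.le hp0.le hβ0 _ _
    fun i => (h.eps_pos_all hμ0 hμ1 k i).le).trans (hanti (Nat.zero_le k))

theorem IsGenerated.exists_isProxBound (h : IsGenerated f lam p β μ αbar α X Y ε)
    (hβ : 0 < β) (hsmooth : IsLSmooth f L) {R : ℝ} (hR : ∀ k, ‖X k‖ ≤ R) :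
    ∃ C, 0 < C ∧ IsProxBound f β X Y C := by
  have hR0 : 0 ≤ R := (norm_nonneg _).trans (hR 0)
  have hL := hsmooth.2.1
  have hα0 : 0 ≤ αbar := (h.alpha_mem 0).1.trans (h.alpha_mem 0).2
  set S := R + αbar * (R + R) with hS
  have hS0 : 0 ≤ S := by positivity
  have hYS (k : ℕ) : ‖Y k‖ ≤ S := by
    obtain ⟨h0, h1⟩ := h.alpha_mem k
    rw [h.extrapolate k]
    calc _ ≤ ‖X k‖ + ‖α k • (X k - X (k - 1))‖ := norm_add_le _ _
      _ ≤ ‖X k‖ + α k * (‖X k‖ + ‖X (k - 1)‖) := by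
        rw [norm_smul, Real.norm_of_nonneg h0]
        gcongr
        exact norm_sub_le _ _
      _ ≤ S := by
        rw [hS]
        gcongr <;> exact hR _
  have hg (k : ℕ) : ‖grad f (Y k)‖ ≤ ‖grad f 0‖ + L * S := by
    have h1 := hsmooth.2.2 (Y k) 0
    rw [sub_zero] at h1
    have h2 := norm_le_norm_add_norm_sub' (grad f (Y k)) (grad f 0)
    have h3 := mul_le_mul_of_nonneg_left (hYS k) hL
    linarith
  refine ⟨1 / 2 * (R + S) + 1 / (2 * β) * (‖grad f 0‖ + L * S) + 1, by positivity,
    fun k i => (sv_le_norm _ i).trans ?_⟩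
  calc _ ≤ ‖(1 / 2 : ℝ) • (X k + Y k)‖ + ‖(1 / (2 * β)) • grad f (Y k)‖ := norm_sub_le _ _
    _ ≤ 1 / 2 * (R + S) + 1 / (2 * β) * (‖grad f 0‖ + L * S) := by
      rw [norm_smul, norm_smul, Real.norm_of_nonneg (by positivity),
        Real.norm_of_nonneg (by positivity)]
      gcongr
      · exact (norm_add_le _ _).trans (add_le_add (hR k) (hYS k))
      · exact hg k
    _ ≤ _ := by linarith

theorem svThreshold_pos {C : ℝ} (hlam : 0 < lam) (hp0 : 0 < p) (hβ : 0 < β) (hC : 0 < C) :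
    0 < svThreshold lam p β C :=
  Real.rpow_pos_of_pos (by positivity) _

theorem IsGenerated.svThreshold_le (h : IsGenerated f lam p β μ αbar α X Y ε)
    (hlam : 0 < lam) (hp0 : 0 < p) (hp1 : p < 1) (hβ : 0 < β) (hμ0 : 0 < μ) (hμ1 : μ < 1)
    {C : ℝ} (hC0 : 0 < C) (hC : IsProxBound f β X Y C) (k : ℕ) (i : Fin m)
    (hi : (i : ℕ) + 1 = (X (k + 1)).rank) : svThreshold lam p β C ≤ sv (X k) i + ε k i :=
  svThreshold_le_of_minimizer hlam hp0 hp1 hβ hC0 (h.eps_pos_all hμ0 hμ1 k) (h.minimize k) (hC k)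
    i hi

/-! ### Rank identification and limit points -/

/-- The perturbation of an index that is recurrently positive tends to zero. -/
theorem IsGenerated.tendsto_eps (h : IsGenerated f lam p β μ αbar α X Y ε) (hμ0 : 0 < μ)
    (hμ1 : μ < 1) (i : Fin m) (hi : ∃ᶠ k in atTop, (i : ℕ) < (X k).rank) :
    Tendsto (fun k => ε k i) atTop (𝓝 0) := by
  refine tendsto_zero_of_frequently_contracted hμ1 (fun k => (h.eps_pos_all hμ0 hμ1 k i).le)
    (h.antitone_eps hμ0 hμ1 i) ?_
  rw [frequently_atTop] at hi ⊢
  intro N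
  obtain ⟨k, hk, hki⟩ := hi (N + 1)
  obtain ⟨l, rfl⟩ : ∃ l, k = l + 1 := ⟨k - 1, by omega⟩
  exact ⟨l, by omega, ((h.update l).pos_and_le_of_mem hμ0 (h.eps_pos_all hμ0 hμ1 l)
    ((mem_posIdx _ i).2 hki)).2⟩

/-- Rank identification. If rank `r` recurs, the perturbation `ε k (r - 1)` tends to zero, so that
the threshold bound forces the `r`-th singular value of an iterate to be positive as soon as the
next iterate has rank `r`. -/
theorem IsGenerated.exists_eventually_rank_eq (h : IsGenerated f lam p β μ αbar α X Y ε)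
    (hlam : 0 < lam) (hp0 : 0 < p) (hp1 : p < 1) (hβ : 0 < β) (hμ0 : 0 < μ) (hμ1 : μ < 1)
    {C : ℝ} (hC0 : 0 < C) (hC : IsProxBound f β X Y C) :
    ∃ r, ∀ᶠ k in atTop, (X k).rank = r := by
  refine exists_eventually_eq_of_backward (M := m) (fun k => (X k).rank_le_height)
    fun r hr => ?_
  obtain rfl | hr0 := Nat.eq_zero_or_pos r
  · exact Eventually.of_forall fun k _ => Nat.zero_le _
  have hrm : r ≤ m := by
    obtain ⟨k, hk⟩ := hr.exists
    exact hk ▸ (X k).rank_le_height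
  let i : Fin m := ⟨r - 1, by omega⟩
  have hi : (i : ℕ) + 1 = r := Nat.sub_add_cancel hr0
  have hε := h.tendsto_eps hμ0 hμ1 i (hr.mono fun k hk => by omega)
  filter_upwards [hε.eventually_lt_const (svThreshold_pos hlam hp0 hβ hC0)] with k hk hkr
  have hle := h.svThreshold_le hlam hp0 hp1 hβ hμ0 hμ1 hC0 hC k i (by omega)
  have := (sv_pos_iff (X k) i).1 (by linarith)
  omega

/-- At a limit point, the singular values up to the final rank are bounded below by the
threshold. -/
theorem IsGenerated.svThreshold_le_of_isLimitPoint (h : IsGenerated f lam p β μ αbar α X Y ε)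
    (hlam : 0 < lam) (hp0 : 0 < p) (hp1 : p < 1) (hβ : 0 < β) (hμ0 : 0 < μ) (hμ1 : μ < 1)
    {C : ℝ} (hC0 : 0 < C) (hC : IsProxBound f β X Y C) {r : ℕ}
    (hr : ∀ᶠ k in atTop, (X k).rank = r) {Xlim : Matrix (Fin m) (Fin n) ℝ}
    (hlim : IsLimitPoint X Xlim) (i : Fin m) (hi : (i : ℕ) < r) :
    svThreshold lam p β C ≤ sv Xlim i := by
  obtain ⟨φ, hφ, hφlim⟩ := hlim
  have hrm : r ≤ m := by
    obtain ⟨k, hk⟩ := hr.exists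
    exact hk ▸ (X k).rank_le_height
  -- It suffices to treat the last of these singular values, which is the smallest.
  let l : Fin m := ⟨r - 1, by omega⟩
  have hl : (l : ℕ) + 1 = r := Nat.sub_add_cancel (by omega)
  have hli : sv Xlim l ≤ sv Xlim i :=
    LinearMap.singularValues_antitone _ (show (i : ℕ) ≤ (l : ℕ) by omega)
  refine le_trans ?_ hli
  have hε := (h.tendsto_eps hμ0 hμ1 l (hr.mono fun k hk => by omega).frequently).comp
    hφ.tendsto_atTop
  have hbound : ∀ᶠ j in atTop,
      svThreshold lam p β C ≤ sv Xlim l + (‖X (φ j) - Xlim‖ + ε (φ j) l) := by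
    have hr' := (tendsto_add_atTop_nat 1).eventually hr
    filter_upwards [hφ.tendsto_atTop.eventually hr'] with j hj
    have h1 := h.svThreshold_le hlam hp0 hp1 hβ hμ0 hμ1 hC0 hC (φ j) l (by omega)
    have h2 := sv_sub_le (X (φ j)) Xlim l
    linarith
  have hlim' := (hφlim.add hε).const_add (sv Xlim l)
  rw [add_zero, add_zero] at hlim'
  exact ge_of_tendsto hlim' hbound

theorem sv_eq_zero_of_isLimitPoint {r : ℕ} (hr : ∀ᶠ k in atTop, (X k).rank = r)
    {Xlim : Matrix (Fin m) (Fin n) ℝ} (hlim : IsLimitPoint X Xlim) (i : Fin m)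
    (hi : r ≤ (i : ℕ)) : sv Xlim i = 0 := by
  obtain ⟨φ, hφ, hφlim⟩ := hlim
  refine le_antisymm (ge_of_tendsto hφlim ?_) (sv_nonneg _ _)
  filter_upwards [hφ.tendsto_atTop.eventually hr] with j hj
  have h1 := abs_le.1 (abs_sv_sub_le (X (φ j)) Xlim i)
  have h2 := not_lt.1 ((sv_pos_iff (X (φ j)) i).not.2 (by omega))
  linarith [h1.1]

end Generated

end EIRNRI

theorem mainTheorem1 {m n : ℕ} (hmn : m ≤ n)
    (f : Matrix (Fin m) (Fin n) ℝ → ℝ) (L lam p β μ αbar : ℝ)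
    (hlam : 0 < lam) (hp0 : 0 < p) (hp1 : p < 1) (hβ : L < β) (hμ0 : 0 < μ) (hμ1 : μ < 1)
    (hsmooth : EIRNRI.IsLSmooth f L)
    (hlevel : EIRNRI.IsLevelBounded (EIRNRI.objective f lam p))
    (hαbar : EIRNRI.IsAdmissibleBound f L β αbar)
    (α : ℕ → ℝ) (X Y : ℕ → Matrix (Fin m) (Fin n) ℝ) (ε : ℕ → Fin m → ℝ)
    (hgen : EIRNRI.IsGenerated f lam p β μ αbar α X Y ε) :
    (∃ C₁ : ℝ, 0 < C₁ ∧ EIRNRI.IsProxBound f β X Y C₁) ∧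
    ∃ Istar : Finset (Fin m),
      (∀ᶠ k in Filter.atTop, EIRNRI.posIdx (X k) = Istar) ∧
      (∀ᶠ k in Filter.atTop, (X k).rank = Istar.card) ∧
      ∀ Xstar : Matrix (Fin m) (Fin n) ℝ, EIRNRI.IsLimitPoint X Xstar →
        Xstar.rank = (EIRNRI.posIdx Xstar).card ∧
        (EIRNRI.posIdx Xstar).card = Istar.card ∧
        ∀ C₁ : ℝ, 0 < C₁ → EIRNRI.IsProxBound f β X Y C₁ →
          0 < (lam * p / (2 * β * C₁)) ^ (1 / (1 - p)) ∧
          ∀ i ∈ EIRNRI.posIdx Xstar,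
            (lam * p / (2 * β * C₁)) ^ (1 / (1 - p)) ≤ EIRNRI.sv Xstar i := by
  have hβ0 : 0 < β := hsmooth.2.1.trans_lt hβ
  obtain ⟨R, hR⟩ := hgen.exists_norm_le hlam hp0 hp1 hβ hμ0 hμ1 hsmooth hlevel hαbar
  obtain ⟨C, hC0, hC⟩ := hgen.exists_isProxBound hβ0 hsmooth hR
  obtain ⟨r, hr⟩ := hgen.exists_eventually_rank_eq hlam hp0 hp1 hβ0 hμ0 hμ1 hC0 hC
  have hrm : r ≤ m := by
    obtain ⟨k, hk⟩ := hr.exists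
    exact hk ▸ (X k).rank_le_height
  refine ⟨⟨C, hC0, hC⟩, Finset.univ.filter fun i : Fin m => (i : ℕ) < r,
    hr.mono fun k hk => by rw [EIRNRI.posIdx_eq_filter, hk],
    hr.mono fun k hk => by rw [EIRNRI.card_filter_val_lt hrm, hk], fun Xstar hlim => ?_⟩
  have hmem (i : Fin m) : i ∈ EIRNRI.posIdx Xstar ↔ (i : ℕ) < r := by
    rw [EIRNRI.mem_posIdx, ← EIRNRI.sv_pos_iff]
    refine ⟨fun hi => ?_, fun hi => ?_⟩
    · by_contra! hle
      exact hi.ne' (EIRNRI.sv_eq_zero_of_isLimitPoint hr hlim i hle)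
    · exact (EIRNRI.svThreshold_pos hlam hp0 hβ0 hC0).trans_le
        (hgen.svThreshold_le_of_isLimitPoint hlam hp0 hp1 hβ0 hμ0 hμ1 hC0 hC hr hlim i hi)
  refine ⟨(EIRNRI.card_posIdx Xstar).symm, congrArg Finset.card (by ext i; simp [hmem]),
    fun C₁ hC₁0 hC₁ => ⟨EIRNRI.svThreshold_pos hlam hp0 hβ0 hC₁0, fun i hi => ?_⟩⟩
  exact hgen.svThreshold_le_of_isLimitPoint hlam hp0 hp1 hβ0 hμ0 hμ1 hC₁0 hC₁ hr hlim i
    ((hmem i).1 hi)
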